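/- Let $G$ be a group (finite or infinite), let $H$ be a subgroup of $G$, and let $W$ be a subset (for example, a subgroup) of a finitely generated group $F$ whose abelianisation $F/F'$ is infinite, where $F'=[F,F]$ is the commutator subgroup. Then the number of homomorphisms $f\colon F\to G$ such that $f(W)\subseteq H$ is divisible by $|H|$. Here numbers of elements are cardinals and divisibility is that of cardinal arithmetic: a cardinal $a$ divides a cardinal $b$ if $b=a\cdot c$ for some cardinal $c$ (so that every infinite cardinal is divisible by every smaller or equal nonzero cardinal, and zero is divisible by every cardinal). -/

import Mathlib

universe u v

/-! Choose a surjection `d : F →* ℤ` and `t` with `d t = 1`. `H` acts on the homomorphisms by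
conjugation and permutes the classes of `HomCoreRel`. The class of `f` has as many elements as
`homCore d.ker H f`: a member is determined by its value `f t * b`, and every `b` in the core occurs
(`bijective_twistHom`). The stabilizer of the class in `H` is the same core
(`homCoreRel_conjHom_iff`). Hence the total is the sum of the stabilizer sizes over the classes,
which by Burnside's count is the number of orbits times `|H|`; all of this is done by bijections, so
finiteness plays no role. -/

/-- If a group `H` acts on `X` preserving an equivalence relation, and each class has as many
elements as its stabilizer in `H`, then `X` is a product of some type with `H`. -/
theorem exists_equiv_prod_of_equiv_stabilizer {H : Type v} {X : Type u} [Group H] [MulAction H X]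
    (r : Setoid X) (hr : ∀ (h : H) (x y : X), r x y → r (h • x) (h • y))
    (e : ∀ x, Nonempty ({h : H // r x (h • x)} ≃ {y // r x y})) :
    ∃ Ω : Type u, Nonempty (X ≃ Ω × H) := by
  let _ : MulAction H (Quotient r) :=
    { smul := fun h => Quotient.map (h • ·) (hr h)
      one_smul := by
        rintro ⟨x⟩
        exact congrArg (Quotient.mk r) (one_smul H x)
      mul_smul := by
        rintro a b ⟨x⟩
        exact congrArg (Quotient.mk r) (mul_smul a b x) }
  have key : ∀ q : Quotient r,
      Nonempty ({x // Quotient.mk r x = q} ≃ MulAction.stabilizer H q) := by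
    refine fun q => Quotient.inductionOn q fun x => ?_
    obtain ⟨f⟩ := e x
    refine ⟨(Equiv.subtypeEquivRight fun y => ?_).trans
      (f.symm.trans (Equiv.subtypeEquivRight fun h => ?_))⟩
    · exact Quotient.eq.trans ⟨r.symm, r.symm⟩
    · exact (show r x (h • x) ↔ r (h • x) x from ⟨r.symm, r.symm⟩).trans Quotient.eq.symm
  let E := fun q => (key q).some
  refine ⟨Quotient (MulAction.orbitRel H (Quotient r)), ⟨?_⟩⟩
  calc X ≃ Σ q : Quotient r, {x // Quotient.mk r x = q} := (Equiv.sigmaFiberEquiv _).symm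
    _ ≃ Σ q : Quotient r, MulAction.stabilizer H q := Equiv.sigmaCongrRight E
    _ ≃ {p : Quotient r × H // p.2 • p.1 = p.1} :=
      (Equiv.subtypeProdEquivSigmaSubtype fun (q : Quotient r) (h : H) =>
        h ∈ MulAction.stabilizer H q).symm
    -- Burnside: the pairs of a group element and a class fixed by it are now grouped by the group
    -- element.
    _ ≃ {p : H × Quotient r // p.1 • p.2 = p.2} :=
      (Equiv.prodComm _ _).subtypeEquiv fun _ => Iff.rfl
    _ ≃ Σ h : H, MulAction.fixedBy (Quotient r) h :=
      Equiv.subtypeProdEquivSigmaSubtype fun (h : H) (q : Quotient r) =>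
        q ∈ MulAction.fixedBy (Quotient r) h
    _ ≃ _ := MulAction.sigmaFixedByEquivOrbitsProdGroup H (Quotient r)

/-- A finitely generated group with infinite abelianization maps onto the infinite cyclic group. -/
theorem exists_surjective_multiplicative_int (F : Type u) [Group F] [Group.FG F]
    [Infinite (Abelianization F)] : ∃ d : F →* Multiplicative ℤ, Function.Surjective d := by
  have : Group.FG (Abelianization F) :=
    Group.fg_of_surjective (f := Abelianization.of) QuotientGroup.mk_surjective
  obtain ⟨ι, j, _, _, p, hp, n, ⟨e⟩⟩ :=
    CommGroup.equiv_free_prod_prod_multiplicative_zmod (Abelianization F)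
  have (i : ι) : NeZero (p i ^ n i) := ⟨pow_ne_zero _ (hp i).ne_zero⟩
  have (i : ι) : Finite (Multiplicative (ZMod (p i ^ n i))) :=
    inferInstanceAs (Finite (ZMod (p i ^ n i)))
  rcases isEmpty_or_nonempty j with h | ⟨⟨i⟩⟩
  -- Without a free factor the abelianization would be a finite product of finite cyclic groups.
  · exact (not_finite_iff_infinite.2 ‹Infinite (Abelianization F)› (Finite.of_equiv _ e.symm.toEquiv)).elim
  · refine ⟨(((Pi.evalMonoidHom _ i).comp (MonoidHom.fst _ _)).comp e.toMonoidHom).comp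
      Abelianization.of, ?_⟩
    exact (((Function.surjective_eval i).comp Prod.fst_surjective).comp e.surjective).comp
      QuotientGroup.mk_surjective

section Core

variable {F : Type u} [Group F] {G : Type v} [Group G]

/-- The elements of `G` that centralize `f K` and all of whose conjugates by elements of the range
of `f` lie in `H`. -/
def homCore (K : Subgroup F) (H : Subgroup G) (f : F →* G) : Subgroup G where
  carrier := {b | (∀ k ∈ K, b * f k = f k * b) ∧ ∀ g, f g * b * (f g)⁻¹ ∈ H}
  one_mem' := by simp [H.one_mem]
  mul_mem' := by
    rintro a b ⟨ha, ha'⟩ ⟨hb, hb'⟩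
    refine ⟨fun k hk => by rw [mul_assoc, hb k hk, ← mul_assoc, ha k hk, mul_assoc], fun g => ?_⟩
    have := H.mul_mem (ha' g) (hb' g)
    simpa [mul_assoc] using this
  inv_mem' := by
    rintro a ⟨ha, ha'⟩
    refine ⟨fun k hk => ?_, fun g => ?_⟩
    · rw [inv_mul_eq_iff_eq_mul, ← mul_assoc, ha k hk, mul_inv_cancel_right]
    · have := H.inv_mem (ha' g)
      simpa [mul_assoc] using this

variable {K : Subgroup F} {H : Subgroup G} {f f' : F →* G} {b : G}

theorem homCore_le : homCore K H f ≤ H := fun b hb => by simpa using hb.2 1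

theorem conj_mem_homCore [hK : K.Normal] (hb : b ∈ homCore K H f) (g : F) :
    f g * b * (f g)⁻¹ ∈ homCore K H f := by
  refine ⟨fun k hk => ?_, fun x => ?_⟩
  · have := hb.1 _ (hK.conj_mem k hk g⁻¹)
    simp only [map_mul, map_inv, inv_inv] at this
    calc f g * b * (f g)⁻¹ * f k = f g * (b * ((f g)⁻¹ * f k * f g)) * (f g)⁻¹ := by group
      _ = f k * (f g * b * (f g)⁻¹) := by rw [this]; group
  · simpa [mul_assoc] using hb.2 (x * g)

theorem map_mem_normalizer_homCore [K.Normal] (g : F) :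
    f g ∈ Subgroup.normalizer (homCore K H f : Set G) := by
  rw [Subgroup.mem_normalizer_iff]
  refine fun b => ⟨fun hb => conj_mem_homCore hb g, fun hb => ?_⟩
  simpa [mul_assoc] using conj_mem_homCore hb g⁻¹

/-- Two homomorphisms that agree on `K` and elsewhere differ by elements of the core. -/
def HomCoreRel (K : Subgroup F) (H : Subgroup G) (f f' : F →* G) : Prop :=
  (∀ k ∈ K, f' k = f k) ∧ ∀ g, (f g)⁻¹ * f' g ∈ homCore K H f

/-- Writing `f' g = f g * c` with `c` in the core of `f`, conjugating `b` by `f' g` amounts to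
conjugating `c * b * c⁻¹`, again in that core, by `f g`. -/
theorem HomCoreRel.homCore_le (h : HomCoreRel K H f f') : homCore K H f ≤ homCore K H f' := by
  refine fun b hb => ⟨fun k hk => by rw [h.1 k hk, hb.1 k hk], fun g => ?_⟩
  have := (mul_mem (mul_mem (h.2 g) hb) (inv_mem (h.2 g))).2 g
  simpa [mul_assoc] using this

theorem HomCoreRel.symm (h : HomCoreRel K H f f') : HomCoreRel K H f' f := by
  refine ⟨fun k hk => (h.1 k hk).symm, fun g => h.homCore_le ?_⟩
  simpa using inv_mem (h.2 g)

/-- `HomCoreRel` as an equivalence relation. -/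
def homCoreSetoid (K : Subgroup F) (H : Subgroup G) : Setoid (F →* G) where
  r := HomCoreRel K H
  iseqv :=
    { refl := fun f => ⟨fun _ _ => rfl, fun g => by simp [one_mem]⟩
      symm := HomCoreRel.symm
      trans := by
        intro f₁ f₂ f₃ h h'
        refine ⟨fun k hk => (h'.1 k hk).trans (h.1 k hk), fun g => ?_⟩
        simpa [mul_assoc] using mul_mem (h.2 g) (h.symm.homCore_le (h'.2 g)) }

/-- The conjugate of a homomorphism. -/
def conjHom (h : G) (f : F →* G) : F →* G := (MulAut.conj h).toMonoidHom.comp f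

@[simp]
theorem conjHom_apply (h : G) (f : F →* G) (g : F) : conjHom h f g = h * f g * h⁻¹ := rfl

theorem conj_mem_homCore_conjHom {h : G} (hh : h ∈ H) (hb : b ∈ homCore K H f) :
    h * b * h⁻¹ ∈ homCore K H (conjHom h f) := by
  refine ⟨fun k hk => ?_, fun g => ?_⟩
  · have := hb.1 k hk
    simp only [conjHom_apply]
    calc h * b * h⁻¹ * (h * f k * h⁻¹) = h * (b * f k) * h⁻¹ := by group
      _ = h * f k * h⁻¹ * (h * b * h⁻¹) := by rw [this]; group
  · simpa [mul_assoc] using H.mul_mem (H.mul_mem hh (hb.2 g)) (H.inv_mem hh)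

theorem HomCoreRel.conjHom {h : G} (hh : h ∈ H) (hf : HomCoreRel K H f f') :
    HomCoreRel K H (conjHom h f) (conjHom h f') := by
  refine ⟨fun k hk => by simp [hf.1 k hk], fun g => ?_⟩
  simpa [mul_assoc] using conj_mem_homCore_conjHom hh (hf.2 g)

theorem homCoreRel_conjHom_iff [K.Normal] {h : G} (hh : h ∈ H) :
    HomCoreRel K H f (conjHom h f) ↔ h ∈ homCore K H f := by
  constructor
  · refine fun hf => ⟨fun k hk => mul_inv_eq_iff_eq_mul.1 (hf.1 k hk), fun g => ?_⟩
    simpa [mul_assoc] using H.mul_mem (homCore_le (hf.2 g⁻¹)) hh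
  · refine fun hb => ⟨fun k hk => mul_inv_eq_iff_eq_mul.2 (hb.1 k hk), fun g => ?_⟩
    simpa [mul_assoc] using mul_mem (conj_mem_homCore hb g⁻¹) (inv_mem hb)

/-- Changing an element modulo a subgroup that it normalizes changes its powers modulo that
subgroup. -/
theorem zpow_inv_mul_mul_zpow_mem {B : Subgroup G} {x : G}
    (hx : x ∈ Subgroup.normalizer (B : Set G)) (hb : b ∈ B) (m : ℤ) :
    (x ^ m)⁻¹ * (x * b) ^ m ∈ B := by
  -- In the quotient of the normalizer by `B`, `x * b` and `x` coincide, hence so do their powers.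
  let N := Subgroup.normalizer (B : Set G)
  let y : N := ⟨x, hx⟩
  let c : N := ⟨b, Subgroup.le_normalizer hb⟩
  have hc : ((c : N) : N ⧸ B.subgroupOf N) = 1 :=
    (QuotientGroup.eq_one_iff c).2 (Subgroup.mem_subgroupOf.2 hb)
  have : (y ^ m)⁻¹ * (y * c) ^ m ∈ B.subgroupOf N := QuotientGroup.eq.1 <| by
    rw [QuotientGroup.mk_zpow, QuotientGroup.mk_zpow, QuotientGroup.mk_mul, hc, mul_one]
  exact Subgroup.mem_subgroupOf.1 this

variable {d : F →* Multiplicative ℤ} {t : F}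

theorem mul_zpow_neg_mem_ker (ht : d t = Multiplicative.ofAdd 1) (g : F) :
    g * (t ^ (d g).toAdd)⁻¹ ∈ d.ker := by
  rw [MonoidHom.mem_ker, map_mul, map_inv, map_zpow, ht, ← ofAdd_zsmul]
  simp

theorem zpow_inv_mul_mul_zpow_mem_homCore (t : F) (hb : b ∈ homCore d.ker H f) (m : ℤ) :
    (f t ^ m)⁻¹ * (f t * b) ^ m ∈ homCore d.ker H f :=
  zpow_inv_mul_mul_zpow_mem (map_mem_normalizer_homCore t) hb m

/-- The homomorphism that agrees with `f` on the kernel of `d` and takes `t` to `f t * b`. -/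
def twistHom (ht : d t = Multiplicative.ofAdd 1) (hb : b ∈ homCore d.ker H f) : F →* G :=
  MonoidHom.mk' (fun g => f g * ((f t ^ (d g).toAdd)⁻¹ * (f t * b) ^ (d g).toAdd)) <| by
    intro g g'
    -- Multiplicativity rests on this: `g' * t ^ (-n)`, with `n` the degree of `g'`, lies in
    -- `d.ker`, so its image commutes with the core element correcting `f g`.
    have h := (zpow_inv_mul_mul_zpow_mem_homCore t hb (d g).toAdd).1 _ (mul_zpow_neg_mem_ker ht g')
    simp only [map_mul, map_inv, map_zpow] at h
    simp only [map_mul, toAdd_mul, zpow_add]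
    generalize (d g).toAdd = m at *
    generalize (d g').toAdd = n at *
    calc f g * f g' * ((f t ^ m * f t ^ n)⁻¹ * ((f t * b) ^ m * (f t * b) ^ n))
        = f g * (f g' * (f t ^ n)⁻¹ * ((f t ^ m)⁻¹ * (f t * b) ^ m)) * (f t * b) ^ n := by
          simp only [mul_assoc, mul_inv_rev]
      _ = _ := by rw [← h]; simp only [mul_assoc]

theorem twistHom_apply (ht : d t = Multiplicative.ofAdd 1) (hb : b ∈ homCore d.ker H f) (g : F) :
    twistHom ht hb g = f g * ((f t ^ (d g).toAdd)⁻¹ * (f t * b) ^ (d g).toAdd) := rfl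

theorem twistHom_apply_self (ht : d t = Multiplicative.ofAdd 1) (hb : b ∈ homCore d.ker H f) :
    twistHom ht hb t = f t * b := by
  simp [twistHom_apply, ht]

theorem homCoreRel_twistHom (ht : d t = Multiplicative.ofAdd 1) (hb : b ∈ homCore d.ker H f) :
    HomCoreRel d.ker H f (twistHom ht hb) := by
  refine ⟨fun k hk => ?_, fun g => ?_⟩
  · simp [twistHom_apply, MonoidHom.mem_ker.1 hk]
  · rw [twistHom_apply, inv_mul_cancel_left]
    exact zpow_inv_mul_mul_zpow_mem_homCore t hb _

theorem hom_ext_of_eqOn_ker (ht : d t = Multiplicative.ofAdd 1) (hk : ∀ k ∈ d.ker, f k = f' k)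
    (h : f t = f' t) : f = f' := by
  ext g
  have := hk _ (mul_zpow_neg_mem_ker ht g)
  simpa [h] using this

/-- The elements of the core of `f` correspond to the homomorphisms equivalent to `f`. -/
theorem bijective_twistHom (ht : d t = Multiplicative.ofAdd 1) (H : Subgroup G) (f : F →* G) :
    Function.Bijective fun b : homCore d.ker H f =>
      (⟨twistHom ht b.2, homCoreRel_twistHom ht b.2⟩ : {f' // HomCoreRel d.ker H f f'}) := by
  constructor
  · intro b c h
    have := DFunLike.congr_fun (congrArg Subtype.val h) t
    simpa [twistHom_apply_self] using this
  · rintro ⟨f', hf⟩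
    refine ⟨⟨_, hf.2 t⟩, Subtype.ext (hom_ext_of_eqOn_ker ht (fun k hk => ?_) ?_)⟩
    · exact ((homCoreRel_twistHom ht (hf.2 t)).1 k hk).trans (hf.1 k hk).symm
    · exact (twistHom_apply_self ht (hf.2 t)).trans (mul_inv_cancel_left _ _)

/-- A set of homomorphisms that is closed under conjugation by `H` and under `HomCoreRel` is
a product of some type with `H`. -/
theorem exists_equiv_prod_of_homCoreRel (ht : d t = Multiplicative.ofAdd 1) (H : Subgroup G)
    (P : (F →* G) → Prop) (hconj : ∀ f, P f → ∀ h ∈ H, P (conjHom h f))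
    (hrel : ∀ f f', P f → HomCoreRel d.ker H f f' → P f') :
    ∃ Ω : Type (max u v), Nonempty ({f // P f} ≃ Ω × H) := by
  let _ : MulAction H {f // P f} :=
    { smul := fun h f => ⟨conjHom h f.1, hconj _ f.2 h h.2⟩
      one_smul := by
        rintro ⟨f, hf⟩
        refine Subtype.ext (MonoidHom.ext fun g => ?_)
        show ((1 : H) : G) * f g * ((1 : H) : G)⁻¹ = f g
        simp
      mul_smul := by
        rintro a b ⟨f, hf⟩
        refine Subtype.ext (MonoidHom.ext fun g => ?_)
        show ((a * b : H) : G) * f g * ((a * b : H) : G)⁻¹ = a * (b * f g * (b : G)⁻¹) * (a : G)⁻¹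
        simp [mul_assoc] }
  refine exists_equiv_prod_of_equiv_stabilizer ((homCoreSetoid d.ker H).comap Subtype.val)
    (fun h f f' hf => HomCoreRel.conjHom h.2 hf) fun f => ⟨?_⟩
  calc {h : H // HomCoreRel d.ker H f.1 (conjHom h f.1)}
      ≃ {h : H // (h : G) ∈ homCore d.ker H f.1} :=
        Equiv.subtypeEquivRight fun h => homCoreRel_conjHom_iff h.2
    _ ≃ homCore d.ker H f.1 := Equiv.subtypeSubtypeEquivSubtype fun h => homCore_le h
    _ ≃ {f' // HomCoreRel d.ker H f.1 f'} := Equiv.ofBijective _ (bijective_twistHom ht H f.1)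
    _ ≃ {f' : {f // P f} // HomCoreRel d.ker H f.1 f'.1} :=
        (Equiv.subtypeSubtypeEquivSubtype fun h => hrel _ _ f.2 h).symm

end Core

theorem corollary5 {F : Type u} [Group F] [Group.FG F] [Infinite (Abelianization F)]
    {G : Type v} [Group G] (H : Subgroup G) (W : Set F) :
    Cardinal.lift.{u} (Cardinal.mk H) ∣
      Cardinal.mk {f : F →* G // ∀ w ∈ W, f w ∈ H} := by
  obtain ⟨d, hd⟩ := exists_surjective_multiplicative_int F
  obtain ⟨t, ht⟩ := hd (Multiplicative.ofAdd 1)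
  obtain ⟨Ω, ⟨e⟩⟩ := exists_equiv_prod_of_homCoreRel ht H (fun f : F →* G => ∀ w ∈ W, f w ∈ H)
    (fun f hf h hh w hw => H.mul_mem (H.mul_mem hh (hf w hw)) (H.inv_mem hh))
    (fun f f' hf hr w hw => by simpa using H.mul_mem (hf w hw) (homCore_le (hr.2 w)))
  refine ⟨Cardinal.mk Ω, ?_⟩
  rw [Cardinal.mk_congr e, Cardinal.mk_prod, mul_comm, Cardinal.lift_id'.{v, max u v}]
  exact congrArg (· * _) (congrFun Cardinal.lift_umax.{v, u} _)
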